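/- **Setting.** A base station (BS) with $M$ antennas serves $K\ge 2$ single-antenna users through a reconfigurable intelligent surface (RIS) with $N$ elements, in the presence of an eavesdropper (Eve) with $M_{\rm E}$ antennas, $M>K+M_{\rm E}$, with artificial noise. The total power is $P>0$, the fraction of it used for information is $\xi\in(0,1)$, the noise variance at user $k$ is $\sigma_k^2$; the path losses are $\beta_1>0$ (BS-RIS), $\beta_{{\rm I},k}>0$ (RIS-user $k$), $\beta_{2,k}\ge 0$ (BS-user $k$), $\beta_{\rm I,E}>0$ (RIS-Eve), $\beta_3\ge 0$ (BS-Eve). The line-of-sight BS-RIS channel is $\mathbf H_1\in\mathbb C^{M\times N}$, $[\mathbf H_1]_{m,n}=\sqrt{\beta_1}\,e^{-j2\pi d_{m,n}/\lambda}$, and $\mathbf\Phi={\rm diag}(e^{j\theta_1},\dots,e^{j\theta_N})$ is the RIS phase shift matrix. Fading is uncorrelated, i.e. all correlation matrices are identity matrices, so that $$\mathbf R_k=\beta_{2,k}\mathbf I_M+\beta_{{\rm I},k}\mathbf H_1\mathbf\Phi\mathbf\Phi^H\mathbf H_1^H,\qquad \mathbf R_{\rm E}=\beta_{\rm I,E}\mathbf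 H_1\mathbf\Phi\mathbf\Phi^H\mathbf H_1^H .$$ The closed-form ergodic secrecy rate of user $k$ is $R_{\rm sec}=[\log_2(1+\gamma_k)-\log_2(1+\gamma_{\rm E})]^+$, where $\log_2(1+\gamma_k)$ is the user's rate, $\log_2(1+\gamma_{\rm E})$ is Eve's capacity, and $$\gamma_k=\frac{\xi P[{\rm tr}(\mathbf R_k)]^2}{\xi P\sum_{i\ne k}{\rm tr}(\mathbf R_k\mathbf R_i)+\sigma_k^2\sum_{j=1}^K{\rm tr}(\mathbf R_j)},\qquad \gamma_{\rm E}=\frac{\xi MM_{\rm E}(M-K)\,{\rm tr}(\mathbf R_k(\mathbf R_{\rm E}+\beta_3\mathbf I_M))}{(1-\xi)(M-K-M_{\rm E})\,{\rm tr}(\mathbf R_{\rm E}+\beta_3\mathbf I_M)\sum_{j=1}^K{\rm tr}(\mathbf R_j)} .$$ **Regime $N\gg M$.** Consider a sequence of such systems in which $M,N,d_{m,n},\theta_n$ may vary (for instance $M$ is fixed and $N\to\infty$) and the other parameters are fixed, with $M/N\to 0$ and $\mathbf H_1\mathbf H_1^H\to\beta_1N\mathbf I_M$ in the sense that $\frac1M\big\Vert\frac1N\mathbf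 H_1\mathbf H_1^H-\beta_1\mathbf I_M\big\Vert_F^2\to 0$ (for fixed $M$ this is entrywise convergence of $\frac1N\mathbf H_1\mathbf H_1^H$ to $\beta_1\mathbf I_M$). **Claim.** Then $\Vert\mathbf H_1\mathbf H_1^H\Vert_F^2\sim\beta_1^2N^2M$, and the secrecy rate takes the simplified form $$R_{\rm sec}=\big[r(M)-c(M)\big]^++o(1),\quad r(M)=\log_2\Big(1+\frac{M\beta_{{\rm I},k}}{\sum_{i\ne k}\beta_{{\rm I},i}}\Big),\quad c(M)=\log_2\Big(1+\frac{\xi M_{\rm E}(M-K)\beta_{{\rm I},k}}{(1-\xi)(M-K-M_{\rm E})\sum_{j=1}^K\beta_{{\rm I},j}}\Big),$$ where moreover the user's rate is $r(M)+o(1)$ and Eve's capacity is $c(M)+o(1)$. The user's rate grows logarithmically in $M$: $r$ is strictly increasing and $r(M)-\log_2M\to\log_2\big(\beta_{{\rm I},k}/\sum_{i\ne k}\beta_{{\rm I},i}\big)$ as $M\to\infty$. Eve's capacity hardly changes with $M$: with $c_\infty=\log_2\Big(1+\frac{\xi M_{\rm E}\beta_{{\rm I},k}}{(1-\xi)\sum_{j}\beta_{{\rm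 I},j}}\Big)$, on $M>K+M_{\rm E}$ the function $c$ is non-increasing and $$c_\infty\le c(M)\le c_\infty+\frac{M_{\rm E}}{(M-K-M_{\rm E})\ln 2}.$$ Consequently, if also $M\to\infty$ along the sequence, then (user's rate) $-\log_2M\to\log_2\big(\beta_{{\rm I},k}/\sum_{i\ne k}\beta_{{\rm I},i}\big)$, Eve's capacity tends to $c_\infty$, and $R_{\rm sec}-\log_2M\to\log_2\big(\beta_{{\rm I},k}/\sum_{i\ne k}\beta_{{\rm I},i}\big)-c_\infty$. -/

import Mathlib

open Filter Topology Asymptotics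
open scoped Matrix

noncomputable section

namespace RIS

/-- The scalar parameters of the system with `K` single-antenna users: total transmit power `P`,
power fraction `ξ` of the information signal, number `ME` of antennas of Eve, noise standard
deviation `σ k` at user `k`, and the path losses `β₁` (BS-RIS), `βI k` (RIS-user `k`),
`β₂ k` (BS-user `k`), `βIE` (RIS-Eve), `β₃` (BS-Eve). -/
structure Params (K : ℕ) where
  P : ℝ
  ξ : ℝ
  ME : ℕ
  σ : Fin K → ℝ
  β₁ : ℝ
  βI : Fin K → ℝ
  β₂ : Fin K → ℝ
  βIE : ℝ
  β₃ : ℝ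

/-- The spatial correlation matrices at the RIS (`RI k`, `RIE`) and at the BS (`RB k`, `RBE`)
of the channels of the users and of Eve. -/
structure Correlation (M N K : ℕ) where
  RI : Fin K → Matrix (Fin N) (Fin N) ℂ
  RB : Fin K → Matrix (Fin M) (Fin M) ℂ
  RIE : Matrix (Fin N) (Fin N) ℂ
  RBE : Matrix (Fin M) (Fin M) ℂ

/-- Uncorrelated Rayleigh fading. -/
def Correlation.uncorrelated (M N K : ℕ) : Correlation M N K where
  RI := fun _ => 1
  RB := fun _ => 1
  RIE := 1
  RBE := 1

/-- The line-of-sight BS-RIS channel `H₁`, with entries `√β₁ exp(-j 2π d / lam)`, where `d m n` is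
the distance between antenna `m` of the BS and element `n` of the RIS. -/
def losChannel {M N : ℕ} (β₁ lam : ℝ) (d : Fin M → Fin N → ℝ) : Matrix (Fin M) (Fin N) ℂ :=
  Matrix.of fun m n =>
    ((Real.sqrt β₁ : ℝ) : ℂ) * Complex.exp (-Complex.I * ((2 * Real.pi * (d m n / lam) : ℝ) : ℂ))

/-- The RIS phase shift matrix `Φ = diag(exp(j θ₁), …, exp(j θ_N))`. -/
def phaseShift {N : ℕ} (θ : Fin N → ℝ) : Matrix (Fin N) (Fin N) ℂ :=
  Matrix.diagonal fun n => Complex.exp (Complex.I * (θ n : ℂ))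

/-- The squared Frobenius norm. -/
def frobSq {m n : ℕ} (A : Matrix (Fin m) (Fin n) ℂ) : ℝ :=
  ∑ i, ∑ j, ‖A i j‖ ^ 2

variable {M N K : ℕ}

/-- The covariance matrix of the equivalent channel from the BS to user `k`:
`R_k = β_{2,k} R_{B,k} + β_{I,k} H₁ Φ R_{I,k} Φᴴ H₁ᴴ`. -/
def userCov (S : Params K) (C : Correlation M N K) (H : Matrix (Fin M) (Fin N) ℂ)
    (Φ : Matrix (Fin N) (Fin N) ℂ) (k : Fin K) : Matrix (Fin M) (Fin M) ℂ :=
  (S.β₂ k : ℂ) • C.RB k + (S.βI k : ℂ) • (H * Φ * C.RI k * Φᴴ * Hᴴ)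

/-- The covariance matrix of Eve's reflected channel: `R_E = β_{I,E} H₁ Φ R_{I,E} Φᴴ H₁ᴴ`. -/
def eveCov (S : Params K) (C : Correlation M N K) (H : Matrix (Fin M) (Fin N) ℂ)
    (Φ : Matrix (Fin N) (Fin N) ℂ) : Matrix (Fin M) (Fin M) ℂ :=
  (S.βIE : ℂ) • (H * Φ * C.RIE * Φᴴ * Hᴴ)

/-- `γ_k = S_k / I_k`. The traces are those of (products of two) positive semidefinite matrices,
hence real. -/
def gammaUser (S : Params K) (C : Correlation M N K) (H : Matrix (Fin M) (Fin N) ℂ)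
    (Φ : Matrix (Fin N) (Fin N) ℂ) (k : Fin K) : ℝ :=
  (S.ξ * S.P * (userCov S C H Φ k).trace.re ^ 2) /
    (S.ξ * S.P * ∑ i ∈ Finset.univ.erase k, (userCov S C H Φ k * userCov S C H Φ i).trace.re
      + S.σ k ^ 2 * ∑ j, (userCov S C H Φ j).trace.re)

/-- `γ_E = S_E / I_E`. -/
def gammaEve (S : Params K) (C : Correlation M N K) (H : Matrix (Fin M) (Fin N) ℂ)
    (Φ : Matrix (Fin N) (Fin N) ℂ) (k : Fin K) : ℝ :=
  (S.ξ * M * S.ME * ((M : ℝ) - K) *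
      (userCov S C H Φ k * (eveCov S C H Φ + (S.β₃ : ℂ) • C.RBE)).trace.re) /
    ((1 - S.ξ) * ((M : ℝ) - K - S.ME) * (eveCov S C H Φ + (S.β₃ : ℂ) • C.RBE).trace.re *
      ∑ j, (userCov S C H Φ j).trace.re)

/-- The achievable rate of user `k` in closed form. -/
def userRate (S : Params K) (C : Correlation M N K) (H : Matrix (Fin M) (Fin N) ℂ)
    (Φ : Matrix (Fin N) (Fin N) ℂ) (k : Fin K) : ℝ :=
  Real.logb 2 (1 + gammaUser S C H Φ k)

/-- The capacity of Eve in closed form. -/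
def eveCapacity (S : Params K) (C : Correlation M N K) (H : Matrix (Fin M) (Fin N) ℂ)
    (Φ : Matrix (Fin N) (Fin N) ℂ) (k : Fin K) : ℝ :=
  Real.logb 2 (1 + gammaEve S C H Φ k)

/-- The closed-form ergodic secrecy rate `R_sec = [log₂(1 + γ_k) - log₂(1 + γ_E)]⁺`. -/
def secrecyRate (S : Params K) (C : Correlation M N K) (H : Matrix (Fin M) (Fin N) ℂ)
    (Φ : Matrix (Fin N) (Fin N) ℂ) (k : Fin K) : ℝ :=
  max 0 (userRate S C H Φ k - eveCapacity S C H Φ k)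

/-- The simplified user rate `log₂(1 + M β_{I,k} / ∑_{i ≠ k} β_{I,i})`. -/
def simpleUserRate (S : Params K) (k : Fin K) (M : ℕ) : ℝ :=
  Real.logb 2 (1 + M * S.βI k / ∑ i ∈ Finset.univ.erase k, S.βI i)

/-- The simplified capacity of Eve,
`log₂(1 + ξ M_E (M - K) β_{I,k} / ((1 - ξ) (M - K - M_E) ∑_j β_{I,j}))`. -/
def simpleEveCapacity (S : Params K) (k : Fin K) (M : ℕ) : ℝ :=
  Real.logb 2 (1 + (S.ξ * S.ME * ((M : ℝ) - K) * S.βI k) /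
    ((1 - S.ξ) * ((M : ℝ) - K - S.ME) * ∑ j, S.βI j))

/-- The simplified secrecy rate. -/
def simpleSecrecyRate (S : Params K) (k : Fin K) (M : ℕ) : ℝ :=
  max 0 (simpleUserRate S k M - simpleEveCapacity S k M)

/-- `log₂(1 + ξ M_E β_{I,k} / ((1 - ξ) ∑_j β_{I,j}))`, which does not depend on `M`. -/
def eveCapacityLimit (S : Params K) (k : Fin K) : ℝ :=
  Real.logb 2 (1 + (S.ξ * S.ME * S.βI k) / ((1 - S.ξ) * ∑ j, S.βI j))

end RIS

end

namespace RIS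

/-! With identity correlations `Φ Φᴴ = 1`, so every covariance is affine in the Gram matrix `G = H
Hᴴ`, and all traces reduce to `tr G` and `tr G² = ‖G‖²`. The first is exactly `M N β₁`, because the
line-of-sight entries have constant modulus. Hence `‖G/N - β₁ I‖² / M = ‖G‖² / (N² M) - β₁²`, and
the hypothesis on `G` says precisely that `gramRatio` tends to `β₁²`.

Thus `γ_k` is `M`, and `γ_E` is `(M - K) / (M - K - M_E)`, times a gain that is a rational function
of `1/N` and `gramRatio`, continuous at `(0, β₁²)`; noise and direct paths carry factors `1/N` and
vanish (`tendsto_userGain`, `tendsto_eveGain`).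

As `M` may be unbounded, convergence of the gain does not give convergence of `γ_k`. The logarithm
repairs this: `tendsto_logb_one_add_mul_sub` controls the ratio of the arguments instead of their
difference. The behaviour in `M` of the simplified rates is elementary. -/

/-! ### Traces in terms of the Gram matrix -/

lemma phaseShift_mul_conjTranspose {N : ℕ} (θ : Fin N → ℝ) :
    phaseShift θ * (phaseShift θ)ᴴ = 1 := by
  rw [phaseShift, Matrix.diagonal_conjTranspose, Matrix.diagonal_mul_diagonal,
    ← Matrix.diagonal_one]
  congr 1
  funext n
  simp only [Pi.star_apply, Complex.star_def]
  rw [Complex.mul_conj, Complex.normSq_eq_norm_sq, mul_comm, Complex.norm_exp_ofReal_mul_I]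
  simp

lemma userCov_uncorrelated {M N K : ℕ} (S : Params K) (H : Matrix (Fin M) (Fin N) ℂ)
    (θ : Fin N → ℝ) (k : Fin K) :
    userCov S (Correlation.uncorrelated M N K) H (phaseShift θ) k =
      (S.β₂ k : ℂ) • 1 + (S.βI k : ℂ) • (H * Hᴴ) := by
  simp only [userCov, Correlation.uncorrelated, Matrix.mul_one]
  rw [Matrix.mul_assoc H, phaseShift_mul_conjTranspose, Matrix.mul_one]

lemma eveCov_uncorrelated {M N K : ℕ} (S : Params K) (H : Matrix (Fin M) (Fin N) ℂ)
    (θ : Fin N → ℝ) :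
    eveCov S (Correlation.uncorrelated M N K) H (phaseShift θ) +
        (S.β₃ : ℂ) • (Correlation.uncorrelated M N K).RBE =
      (S.β₃ : ℂ) • 1 + (S.βIE : ℂ) • (H * Hᴴ) := by
  simp only [eveCov, Correlation.uncorrelated, Matrix.mul_one]
  rw [Matrix.mul_assoc H, phaseShift_mul_conjTranspose, Matrix.mul_one, add_comm]

lemma frobSq_eq_trace {m n : ℕ} (A : Matrix (Fin m) (Fin n) ℂ) :
    frobSq A = (A * Aᴴ).trace.re := by
  simp only [frobSq, Matrix.trace, Matrix.diag_apply, Matrix.mul_apply, Complex.re_sum,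
    Matrix.conjTranspose_apply, Complex.star_def, Complex.mul_conj, Complex.ofReal_re,
    Complex.normSq_eq_norm_sq]

lemma trace_re_affine {m : ℕ} (G : Matrix (Fin m) (Fin m) ℂ) (a b : ℝ) :
    ((a : ℂ) • (1 : Matrix (Fin m) (Fin m) ℂ) + (b : ℂ) • G).trace.re =
      a * m + b * G.trace.re := by
  simp

lemma trace_re_affine_mul_affine {m : ℕ} (G : Matrix (Fin m) (Fin m) ℂ) (a b c d : ℝ) :
    (((a : ℂ) • (1 : Matrix (Fin m) (Fin m) ℂ) + (b : ℂ) • G) *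
        ((c : ℂ) • (1 : Matrix (Fin m) (Fin m) ℂ) + (d : ℂ) • G)).trace.re =
      a * c * m + (a * d + b * c) * G.trace.re + b * d * (G * G).trace.re := by
  simp only [add_mul, mul_add, Matrix.smul_mul, Matrix.mul_smul, Matrix.one_mul, Matrix.mul_one,
    Matrix.trace_add, Matrix.trace_smul, Matrix.trace_one, smul_eq_mul, Complex.add_re,
    Complex.re_ofReal_mul, Fintype.card_fin, Complex.natCast_re]
  ring

lemma trace_re_losChannel {M N : ℕ} {β₁ : ℝ} (hβ₁ : 0 ≤ β₁) (lam : ℝ)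
    (d : Fin M → Fin N → ℝ) :
    (losChannel β₁ lam d * (losChannel β₁ lam d)ᴴ).trace.re = M * N * β₁ := by
  rw [← frobSq_eq_trace]
  have h : ∀ m n, ‖losChannel β₁ lam d m n‖ ^ 2 = β₁ := by
    intro m n
    have : -Complex.I * ((2 * Real.pi * (d m n / lam) : ℝ) : ℂ) =
        ((-(2 * Real.pi * (d m n / lam)) : ℝ) : ℂ) * Complex.I := by
      rw [Complex.ofReal_neg]; ring
    rw [losChannel, Matrix.of_apply, this, norm_mul, Complex.norm_exp_ofReal_mul_I, mul_one,
      Complex.norm_real, Real.norm_eq_abs, sq_abs, Real.sq_sqrt hβ₁]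
  simp only [frobSq, h, Finset.sum_const, Finset.card_univ, Fintype.card_fin, nsmul_eq_mul]
  ring

lemma frobSq_gram {M N : ℕ} (H : Matrix (Fin M) (Fin N) ℂ) :
    frobSq (H * Hᴴ) = ((H * Hᴴ) * (H * Hᴴ)).trace.re := by
  rw [frobSq_eq_trace, Matrix.conjTranspose_mul, Matrix.conjTranspose_conjTranspose]

/-- The matrix is Hermitian, so its squared norm is the trace of its square. -/
lemma frobSq_smul_gram_sub {M N : ℕ} (H : Matrix (Fin M) (Fin N) ℂ) (b c : ℝ) :
    frobSq ((b : ℂ) • (H * Hᴴ) - (c : ℂ) • (1 : Matrix (Fin M) (Fin M) ℂ)) =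
      c ^ 2 * M - 2 * b * c * (H * Hᴴ).trace.re + b ^ 2 * frobSq (H * Hᴴ) := by
  have h : (b : ℂ) • (H * Hᴴ) - (c : ℂ) • (1 : Matrix (Fin M) (Fin M) ℂ) =
      ((-c : ℝ) : ℂ) • 1 + (b : ℂ) • (H * Hᴴ) := by
    rw [Complex.ofReal_neg, neg_smul]; abel
  have hs : (((-c : ℝ) : ℂ) • 1 + (b : ℂ) • (H * Hᴴ))ᴴ =
      ((-c : ℝ) : ℂ) • 1 + (b : ℂ) • (H * Hᴴ) := by
    simp [Matrix.conjTranspose_add, Matrix.conjTranspose_smul, Matrix.conjTranspose_mul]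
  rw [h, frobSq_eq_trace, hs, trace_re_affine_mul_affine, frobSq_gram]
  ring

/-! ### Normalized gains and their limits -/

/-- The normalized squared Frobenius norm `‖H Hᴴ‖² / (N² M)` of the Gram matrix of a channel. -/
noncomputable def gramRatio {M N : ℕ} (H : Matrix (Fin M) (Fin N) ℂ) : ℝ :=
  frobSq (H * Hᴴ) / ((N : ℝ) ^ 2 * M)

/-- The ratio `γ_k / M` as a function of `b = 1 / N` and the Gram ratio `f`. -/
noncomputable def userGain {K : ℕ} (S : Params K) (k : Fin K) (b f : ℝ) : ℝ :=
  (S.ξ * S.P * (S.β₂ k * b + S.βI k * S.β₁) ^ 2) /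
    (S.ξ * S.P * ∑ i ∈ Finset.univ.erase k,
        (S.β₂ k * S.β₂ i * b ^ 2 + (S.β₂ k * S.βI i + S.βI k * S.β₂ i) * S.β₁ * b +
          S.βI k * S.βI i * f)
      + S.σ k ^ 2 * b * ∑ j, (S.β₂ j * b + S.βI j * S.β₁))

/-- The factor of `(M - K) / (M - K - M_E)` in `γ_E`, as a function of `b = 1 / N` and the Gram
ratio `f`. -/
noncomputable def eveGain {K : ℕ} (S : Params K) (k : Fin K) (b f : ℝ) : ℝ :=
  (S.ξ * S.ME * (S.β₂ k * S.β₃ * b ^ 2 + (S.β₂ k * S.βIE + S.βI k * S.β₃) * S.β₁ * b +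
      S.βI k * S.βIE * f)) /
    ((1 - S.ξ) * (S.β₃ * b + S.βIE * S.β₁) * ∑ j, (S.β₂ j * b + S.βI j * S.β₁))

section

variable {M N K : ℕ} (S : Params K) (H : Matrix (Fin M) (Fin N) ℂ) (θ : Fin N → ℝ) (k : Fin K)

lemma gammaUser_eq (hM : 0 < M) (hN : 0 < N) (htr : (H * Hᴴ).trace.re = M * N * S.β₁) :
    gammaUser S (Correlation.uncorrelated M N K) H (phaseShift θ) k =
      M * userGain S k (N : ℝ)⁻¹ (gramRatio H) := by
  have hM' : (M : ℝ) ≠ 0 := by positivity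
  have hN' : (N : ℝ) ≠ 0 := by positivity
  have h1 : ∀ i, (userCov S (Correlation.uncorrelated M N K) H (phaseShift θ) i).trace.re =
      M * N * (S.β₂ i * (N : ℝ)⁻¹ + S.βI i * S.β₁) := by
    intro i
    rw [userCov_uncorrelated, trace_re_affine, htr]
    field_simp
  have h2 : ∀ i, (userCov S (Correlation.uncorrelated M N K) H (phaseShift θ) k *
      userCov S (Correlation.uncorrelated M N K) H (phaseShift θ) i).trace.re =
      M * N ^ 2 * (S.β₂ k * S.β₂ i * (N : ℝ)⁻¹ ^ 2 +
        (S.β₂ k * S.βI i + S.βI k * S.β₂ i) * S.β₁ * (N : ℝ)⁻¹ +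
          S.βI k * S.βI i * gramRatio H) := by
    intro i
    rw [userCov_uncorrelated, userCov_uncorrelated, trace_re_affine_mul_affine, htr,
      ← frobSq_gram, gramRatio]
    field_simp
  simp only [gammaUser, h1, h2, ← Finset.mul_sum]
  -- The fraction is expanded by `M N²`, the order of the traces of products; the noise term is only
  -- of order `M N`, whence its extra factor `1/N`.
  rw [userGain, ← mul_div_assoc, eq_comm,
    ← mul_div_mul_left _ _ (mul_ne_zero hM' (pow_ne_zero 2 hN'))]
  congr 1
  · ring
  · rw [mul_add, pow_two (N : ℝ), mul_assoc _ (N : ℝ)⁻¹, mul_left_comm _ (N : ℝ)⁻¹,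
      ← mul_assoc _ (N : ℝ)⁻¹, ← mul_assoc (M : ℝ), mul_inv_cancel_right₀ hN']
    ring

lemma gammaEve_eq (hM : 0 < M) (hN : 0 < N) (htr : (H * Hᴴ).trace.re = M * N * S.β₁) :
    gammaEve S (Correlation.uncorrelated M N K) H (phaseShift θ) k =
      ((M : ℝ) - K) / ((M : ℝ) - K - S.ME) * eveGain S k (N : ℝ)⁻¹ (gramRatio H) := by
  have hM' : (M : ℝ) ≠ 0 := by positivity
  have hN' : (N : ℝ) ≠ 0 := by positivity
  have h1 : ∀ i, (userCov S (Correlation.uncorrelated M N K) H (phaseShift θ) i).trace.re =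
      M * N * (S.β₂ i * (N : ℝ)⁻¹ + S.βI i * S.β₁) := by
    intro i
    rw [userCov_uncorrelated, trace_re_affine, htr]
    field_simp
  have h2 : ((S.β₃ : ℂ) • 1 + (S.βIE : ℂ) • (H * Hᴴ)).trace.re =
      M * N * (S.β₃ * (N : ℝ)⁻¹ + S.βIE * S.β₁) := by
    rw [trace_re_affine, htr]
    field_simp
  have h3 : (userCov S (Correlation.uncorrelated M N K) H (phaseShift θ) k *
      ((S.β₃ : ℂ) • 1 + (S.βIE : ℂ) • (H * Hᴴ))).trace.re =
      M * N ^ 2 * (S.β₂ k * S.β₃ * (N : ℝ)⁻¹ ^ 2 +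
        (S.β₂ k * S.βIE + S.βI k * S.β₃) * S.β₁ * (N : ℝ)⁻¹ +
          S.βI k * S.βIE * gramRatio H) := by
    rw [userCov_uncorrelated, trace_re_affine_mul_affine, htr, ← frobSq_gram, gramRatio]
    field_simp
  simp only [gammaEve, eveCov_uncorrelated, h1, h2, h3, ← Finset.mul_sum]
  rw [eveGain, div_mul_div_comm, eq_comm,
    ← mul_div_mul_left _ _ (mul_ne_zero (pow_ne_zero 2 hM') (pow_ne_zero 2 hN'))]
  congr 1
  · ring
  · ring

/-- At `b = 0`, `f = β₁²` only the reflected paths remain and `ξ P β₁²` cancels; the interference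
keeps the denominator nonzero. -/
lemma tendsto_userGain (hP : 0 < S.P) (hξ0 : 0 < S.ξ) (hβ₁ : 0 < S.β₁) (hβI : ∀ i, 0 < S.βI i)
    (hs : 0 < ∑ i ∈ Finset.univ.erase k, S.βI i) {ι : Type*} {l : Filter ι} {b f : ι → ℝ}
    (hb : Tendsto b l (𝓝 0)) (hf : Tendsto f l (𝓝 (S.β₁ ^ 2))) :
    Tendsto (fun t => userGain S k (b t) (f t)) l
      (𝓝 (S.βI k / ∑ i ∈ Finset.univ.erase k, S.βI i)) := by
  have hval : userGain S k 0 (S.β₁ ^ 2) = S.βI k / ∑ i ∈ Finset.univ.erase k, S.βI i := by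
    have hk := hβI k
    simp only [userGain, mul_zero, zero_add, ne_eq, OfNat.ofNat_ne_zero, not_false_eq_true,
      zero_pow, zero_mul, add_zero, ← Finset.sum_mul, ← Finset.mul_sum]
    field_simp
  have hden : S.ξ * S.P * ∑ i ∈ Finset.univ.erase k,
        (S.β₂ k * S.β₂ i * 0 ^ 2 + (S.β₂ k * S.βI i + S.βI k * S.β₂ i) * S.β₁ * 0 +
          S.βI k * S.βI i * S.β₁ ^ 2)
      + S.σ k ^ 2 * 0 * ∑ j, (S.β₂ j * 0 + S.βI j * S.β₁) ≠ 0 := by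
    have hk := hβI k
    simp only [mul_zero, zero_add, ne_eq, OfNat.ofNat_ne_zero, not_false_eq_true,
      zero_pow, zero_mul, add_zero, ← Finset.sum_mul, ← Finset.mul_sum]
    positivity
  rw [← hval]
  refine Tendsto.div ?_ ?_ hden
  · exact (((hb.const_mul _).add_const _).pow 2).const_mul _
  · refine Tendsto.add (Tendsto.const_mul _ (tendsto_finsetSum _ fun i _ => ?_))
      (Tendsto.mul (hb.const_mul _) (tendsto_finsetSum _ fun i _ => ?_))
    · exact (((hb.pow 2).const_mul _).add (hb.const_mul _)).add (hf.const_mul _)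
    · exact (hb.const_mul _).add_const _

lemma tendsto_eveGain (hξ1 : S.ξ < 1) (hβ₁ : 0 < S.β₁) (hβIE : 0 < S.βIE)
    (hs : 0 < ∑ j, S.βI j) {ι : Type*} {l : Filter ι} {b f : ι → ℝ}
    (hb : Tendsto b l (𝓝 0)) (hf : Tendsto f l (𝓝 (S.β₁ ^ 2))) :
    Tendsto (fun t => eveGain S k (b t) (f t)) l
      (𝓝 ((S.ξ * S.ME * S.βI k) / ((1 - S.ξ) * ∑ j, S.βI j))) := by
  have hξ : 0 < 1 - S.ξ := sub_pos.2 hξ1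
  have hval : eveGain S k 0 (S.β₁ ^ 2) =
      (S.ξ * S.ME * S.βI k) / ((1 - S.ξ) * ∑ j, S.βI j) := by
    simp only [eveGain, mul_zero, zero_add, ne_eq, OfNat.ofNat_ne_zero, not_false_eq_true,
      zero_pow, ← Finset.sum_mul]
    field_simp
  have hden : (1 - S.ξ) * (S.β₃ * 0 + S.βIE * S.β₁) * ∑ j, (S.β₂ j * 0 + S.βI j * S.β₁) ≠ 0 := by
    simp only [mul_zero, zero_add, ← Finset.sum_mul]
    positivity
  rw [← hval]
  refine Tendsto.div ?_ ?_ hden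
  · exact ((((hb.pow 2).const_mul _).add (hb.const_mul _)).add (hf.const_mul _)).const_mul _
  · exact Tendsto.mul (((hb.const_mul _).add_const _).const_mul _)
      (tendsto_finsetSum _ fun i _ => (hb.const_mul _).add_const _)

end

/-! ### Asymptotics of logarithmic rates -/

/-- Replacing the gain `x t` by its limit does not change the rate `log₂ (1 + q t * x t)` in the
limit, even for unbounded `q`, provided that `q / (1 + q * x₀)` stays bounded. -/
lemma tendsto_logb_one_add_mul_sub {ι : Type*} {l : Filter ι} {q x : ι → ℝ} {x₀ C : ℝ}
    (hx₀ : 0 ≤ x₀) (hq : ∀ t, 0 ≤ q t) (hC : ∀ t, q t ≤ C * (1 + q t * x₀))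
    (hx : Tendsto x l (𝓝 x₀)) :
    Tendsto (fun t => Real.logb 2 (1 + q t * x t) - Real.logb 2 (1 + q t * x₀)) l (𝓝 0) := by
  have hpos : ∀ t, 0 < 1 + q t * x₀ := fun t => by have := hq t; positivity
  have hd : Tendsto (fun t => q t / (1 + q t * x₀) * (x t - x₀)) l (𝓝 0) := by
    refine squeeze_zero_norm (a := fun t => C * |x t - x₀|) (fun t => ?_) ?_
    · rw [norm_mul, Real.norm_eq_abs, Real.norm_eq_abs,
        abs_of_nonneg (div_nonneg (hq t) (hpos t).le)]
      exact mul_le_mul_of_nonneg_right ((div_le_iff₀ (hpos t)).2 (hC t)) (abs_nonneg _)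
    · simpa using ((hx.sub_const x₀).abs).const_mul C
  have hr : Tendsto (fun t => 1 + q t / (1 + q t * x₀) * (x t - x₀)) l (𝓝 1) := by
    simpa using hd.const_add 1
  have hlog := (Real.continuousAt_logb (b := 2) one_ne_zero).tendsto.comp hr
  rw [Real.logb_one] at hlog
  refine hlog.congr' ?_
  filter_upwards [hr.eventually (lt_mem_nhds one_pos)] with t ht
  have e : 1 + q t / (1 + q t * x₀) * (x t - x₀) = (1 + q t * x t) / (1 + q t * x₀) := by
    have := (hpos t).ne'
    field_simp
    ring
  rw [Function.comp_apply, e, Real.logb_div _ (hpos t).ne']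
  -- A zero argument would make the quotient zero, but near its limit 1 it is positive.
  intro h0
  rw [e, h0, zero_div] at ht
  exact lt_irrefl _ ht

lemma simpleUserRate_eq {K : ℕ} (S : Params K) (k : Fin K) (m : ℕ) :
    simpleUserRate S k m =
      Real.logb 2 (1 + m * (S.βI k / ∑ i ∈ Finset.univ.erase k, S.βI i)) := by
  rw [simpleUserRate, mul_div_assoc]

lemma simpleEveCapacity_eq {K : ℕ} (S : Params K) (k : Fin K) (m : ℕ) :
    simpleEveCapacity S k m =
      Real.logb 2 (1 + ((m : ℝ) - K) / ((m : ℝ) - K - S.ME) *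
        ((S.ξ * S.ME * S.βI k) / ((1 - S.ξ) * ∑ j, S.βI j))) := by
  rw [simpleEveCapacity, div_mul_div_comm]
  congr 3 <;> ring

lemma strictMono_logb_one_add_mul {a : ℝ} (ha : 0 < a) :
    StrictMono fun m : ℕ => Real.logb 2 (1 + m * a) := by
  intro m n hmn
  have : (m : ℝ) < n := by exact_mod_cast hmn
  exact Real.logb_lt_logb one_lt_two (by positivity) (by gcongr)

/-- The difference is the logarithm of `1/m + a`. -/
lemma tendsto_logb_one_add_mul_sub_logb {a : ℝ} (ha : 0 < a) :
    Tendsto (fun m : ℕ => Real.logb 2 (1 + m * a) - Real.logb 2 m) atTop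
      (𝓝 (Real.logb 2 a)) := by
  have h : Tendsto (fun m : ℕ => (m : ℝ)⁻¹ + a) atTop (𝓝 a) := by
    simpa using (tendsto_inv_atTop_nhds_zero_nat (𝕜 := ℝ)).add_const a
  refine ((Real.continuousAt_logb (b := 2) ha.ne').tendsto.comp h).congr' ?_
  filter_upwards [eventually_gt_atTop 0] with m hm
  have hm' : (0 : ℝ) < m := by exact_mod_cast hm
  rw [Function.comp_apply, ← Real.logb_div (by positivity) hm'.ne']
  congr 1
  field_simp

/-- `(m - K) / (m - K - E) = 1 + E / (m - K - E)`. -/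
lemma antennaRatio_eq {m K E : ℕ} (h : K + E < m) :
    0 < (m : ℝ) - K - E ∧ ((m : ℝ) - K) / ((m : ℝ) - K - E) = 1 + E / ((m : ℝ) - K - E) := by
  have h' : (K : ℝ) + E < m := by exact_mod_cast h
  have hp : 0 < (m : ℝ) - K - E := by linarith
  refine ⟨hp, ?_⟩
  rw [eq_comm, one_add_div hp.ne']
  congr 1
  ring

lemma antitoneOn_logb_antennaRatio {e : ℝ} (he : 0 ≤ e) (K E : ℕ) :
    AntitoneOn (fun m : ℕ => Real.logb 2 (1 + ((m : ℝ) - K) / ((m : ℝ) - K - E) * e))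
      {m : ℕ | K + E < m} := by
  intro m hm n hn hmn
  obtain ⟨hpm, hm'⟩ := antennaRatio_eq hm
  obtain ⟨hpn, hn'⟩ := antennaRatio_eq hn
  have : (m : ℝ) ≤ n := by exact_mod_cast hmn
  simp only [hm', hn']
  exact Real.logb_le_logb_of_le one_lt_two (by positivity) (by gcongr)

/-- With ratio `1 + δ`, the argument `1 + (1 + δ) e` lies between `1 + e` and `(1 + e)(1 + δ)`, and
`log (1 + δ) ≤ δ`. -/
lemma logb_antennaRatio_bounds {e : ℝ} (he : 0 ≤ e) {m K E : ℕ} (hm : K + E < m) :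
    Real.logb 2 (1 + e) ≤ Real.logb 2 (1 + ((m : ℝ) - K) / ((m : ℝ) - K - E) * e) ∧
    Real.logb 2 (1 + ((m : ℝ) - K) / ((m : ℝ) - K - E) * e) ≤
      Real.logb 2 (1 + e) + E / (((m : ℝ) - K - E) * Real.log 2) := by
  obtain ⟨hp, hq⟩ := antennaRatio_eq hm
  rw [hq]
  set δ : ℝ := E / ((m : ℝ) - K - E) with hδ
  have hδ0 : 0 ≤ δ := by positivity
  have hlog2 : 0 < Real.log 2 := Real.log_pos one_lt_two
  constructor
  · refine Real.logb_le_logb_of_le one_lt_two (by positivity) ?_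
    nlinarith [mul_nonneg hδ0 he]
  · have h1 : Real.logb 2 (1 + (1 + δ) * e) ≤ Real.logb 2 ((1 + e) * (1 + δ)) :=
      Real.logb_le_logb_of_le one_lt_two (by positivity) (by nlinarith)
    rw [Real.logb_mul (by positivity) (by positivity)] at h1
    have h2 : Real.logb 2 (1 + δ) ≤ E / (((m : ℝ) - K - E) * Real.log 2) := by
      rw [← div_div, ← hδ, Real.logb]
      gcongr
      linarith [Real.log_le_sub_one_of_pos (show 0 < 1 + δ by positivity)]
    linarith

lemma tendsto_logb_antennaRatio {e : ℝ} (he : 0 ≤ e) (K E : ℕ) :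
    Tendsto (fun m : ℕ => Real.logb 2 (1 + ((m : ℝ) - K) / ((m : ℝ) - K - E) * e)) atTop
      (𝓝 (Real.logb 2 (1 + e))) := by
  have hden : Tendsto (fun m : ℕ => ((m : ℝ) - K - E) * Real.log 2) atTop atTop :=
    ((tendsto_atTop_add_const_right _ (-(E : ℝ)) (tendsto_atTop_add_const_right _ (-(K : ℝ))
      tendsto_natCast_atTop_atTop)).atTop_mul_const (Real.log_pos one_lt_two))
  have hup : Tendsto (fun m : ℕ => Real.logb 2 (1 + e) + E / (((m : ℝ) - K - E) * Real.log 2))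
      atTop (𝓝 (Real.logb 2 (1 + e))) := by
    simpa using (hden.const_div_atTop (E : ℝ)).const_add (Real.logb 2 (1 + e))
  refine tendsto_of_tendsto_of_tendsto_of_le_of_le' tendsto_const_nhds hup ?_ ?_
  · filter_upwards [eventually_gt_atTop (K + E)] with m hm
    exact (logb_antennaRatio_bounds he hm).1
  · filter_upwards [eventually_gt_atTop (K + E)] with m hm
    exact (logb_antennaRatio_bounds he hm).2

/-- The positive part is 1-Lipschitz. -/
lemma tendsto_max_zero_sub {ι : Type*} {l : Filter ι} {u v u' v' : ι → ℝ}
    (hu : Tendsto (fun t => u t - u' t) l (𝓝 0)) (hv : Tendsto (fun t => v t - v' t) l (𝓝 0)) :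
    Tendsto (fun t => max 0 (u t - v t) - max 0 (u' t - v' t)) l (𝓝 0) := by
  refine squeeze_zero_norm (a := fun t => |(u t - u' t) - (v t - v' t)|) (fun t => ?_)
    (by simpa using (hu.sub hv).abs)
  have h := abs_max_sub_max_le_abs (u t - v t) (u' t - v' t) 0
  rw [max_comm _ (0 : ℝ), max_comm _ (0 : ℝ)] at h
  rw [Real.norm_eq_abs]
  refine h.trans_eq ?_
  congr 1
  ring

/-- Here `u - v` is `w` plus a convergent term, so it is eventually nonnegative and the positive
part is inactive. -/
lemma tendsto_max_zero_sub_of_atTop {ι : Type*} {l : Filter ι} {u v w : ι → ℝ} {a b : ℝ}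
    (hw : Tendsto w l atTop) (hu : Tendsto (fun t => u t - w t) l (𝓝 a))
    (hv : Tendsto v l (𝓝 b)) :
    Tendsto (fun t => max 0 (u t - v t) - w t) l (𝓝 (a - b)) := by
  have hd := hu.sub hv
  refine hd.congr' ?_
  filter_upwards [(hd.add_atTop hw).eventually_ge_atTop 0] with t ht
  rw [max_eq_right (by linarith)]
  ring

end RIS

theorem corollary2 {K : ℕ} (hK : 2 ≤ K) (S : RIS.Params K) (k : Fin K)
    (hP : 0 < S.P) (hξ0 : 0 < S.ξ) (hξ1 : S.ξ < 1)
    (hβ₁ : 0 < S.β₁) (hβI : ∀ i, 0 < S.βI i) (hβ₂ : ∀ i, 0 ≤ S.β₂ i)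
    (hβIE : 0 < S.βIE) (hβ₃ : 0 ≤ S.β₃)
    (lam : ℝ) (hlam : 0 < lam)
    -- numbers of BS antennas and of RIS elements, in the regime `N ≫ M`
    (M N : ℕ → ℕ) (hM : ∀ t, K + S.ME < M t)
    (hNM : (fun t => (M t : ℝ)) =o[atTop] (fun t => (N t : ℝ)))
    -- BS-RIS distances and RIS phase shifts
    (d : ∀ t, Fin (M t) → Fin (N t) → ℝ) (θ : ∀ t, Fin (N t) → ℝ)
    (H : ∀ t, Matrix (Fin (M t)) (Fin (N t)) ℂ)
    (hH : ∀ t, H t = RIS.losChannel S.β₁ lam (d t))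
    -- `H₁ H₁ᴴ → β₁ N I_M`, in normalized Frobenius norm (for constant `M`: entrywise)
    (hgram : Tendsto (fun t => RIS.frobSq
        ((N t : ℂ)⁻¹ • (H t * (H t)ᴴ) - (S.β₁ : ℂ) • (1 : Matrix (Fin (M t)) (Fin (M t)) ℂ))
          / (M t : ℝ)) atTop (𝓝 0)) :
    -- `‖H₁ H₁ᴴ‖²` is asymptotically `β₁² N² M`
    (fun t => RIS.frobSq (H t * (H t)ᴴ)) ~[atTop]
        (fun t => S.β₁ ^ 2 * (N t : ℝ) ^ 2 * (M t : ℝ)) ∧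
    -- the user's rate, Eve's capacity and the secrecy rate take the simplified form
    Tendsto (fun t =>
        RIS.userRate S (RIS.Correlation.uncorrelated (M t) (N t) K) (H t) (RIS.phaseShift (θ t)) k
          - RIS.simpleUserRate S k (M t)) atTop (𝓝 0) ∧
    Tendsto (fun t =>
        RIS.eveCapacity S (RIS.Correlation.uncorrelated (M t) (N t) K) (H t)
            (RIS.phaseShift (θ t)) k
          - RIS.simpleEveCapacity S k (M t)) atTop (𝓝 0) ∧
    Tendsto (fun t =>
        RIS.secrecyRate S (RIS.Correlation.uncorrelated (M t) (N t) K) (H t)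
            (RIS.phaseShift (θ t)) k
          - RIS.simpleSecrecyRate S k (M t)) atTop (𝓝 0) ∧
    -- the simplified user's rate grows logarithmically in the number of BS antennas
    StrictMono (RIS.simpleUserRate S k) ∧
    Tendsto (fun m : ℕ => RIS.simpleUserRate S k m - Real.logb 2 m) atTop
      (𝓝 (Real.logb 2 (S.βI k / ∑ i ∈ Finset.univ.erase k, S.βI i))) ∧
    -- the simplified capacity of Eve hardly changes with the number of BS antennas
    AntitoneOn (RIS.simpleEveCapacity S k) {m : ℕ | K + S.ME < m} ∧
    (∀ m : ℕ, K + S.ME < m →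
      RIS.eveCapacityLimit S k ≤ RIS.simpleEveCapacity S k m ∧
      RIS.simpleEveCapacity S k m ≤
        RIS.eveCapacityLimit S k + S.ME / (((m : ℝ) - K - S.ME) * Real.log 2)) ∧
    -- the same for the rates themselves when `M` grows (still with `N ≫ M`)
    (Tendsto M atTop atTop →
      Tendsto (fun t =>
          RIS.userRate S (RIS.Correlation.uncorrelated (M t) (N t) K) (H t)
              (RIS.phaseShift (θ t)) k
            - Real.logb 2 (M t)) atTop
        (𝓝 (Real.logb 2 (S.βI k / ∑ i ∈ Finset.univ.erase k, S.βI i))) ∧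
      Tendsto (fun t =>
          RIS.eveCapacity S (RIS.Correlation.uncorrelated (M t) (N t) K) (H t)
              (RIS.phaseShift (θ t)) k) atTop
        (𝓝 (RIS.eveCapacityLimit S k)) ∧
      Tendsto (fun t =>
          RIS.secrecyRate S (RIS.Correlation.uncorrelated (M t) (N t) K) (H t)
              (RIS.phaseShift (θ t)) k
            - Real.logb 2 (M t)) atTop
        (𝓝 (Real.logb 2 (S.βI k / ∑ i ∈ Finset.univ.erase k, S.βI i)
          - RIS.eveCapacityLimit S k))) := by
  -- `2 ≤ K` provides an interfering user.
  have hs : 0 < ∑ i ∈ Finset.univ.erase k, S.βI i := by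
    refine Finset.sum_pos (fun i _ => hβI i) (Finset.card_pos.1 ?_)
    rw [Finset.card_erase_of_mem (Finset.mem_univ k), Finset.card_univ, Fintype.card_fin]
    omega
  have hs' : 0 < ∑ j, S.βI j := Finset.sum_pos (fun i _ => hβI i) ⟨k, Finset.mem_univ k⟩
  have hξ : 0 < 1 - S.ξ := sub_pos.2 hξ1
  set a : ℝ := S.βI k / ∑ i ∈ Finset.univ.erase k, S.βI i with ha_def
  have ha : 0 < a := div_pos (hβI k) hs
  set e : ℝ := (S.ξ * S.ME * S.βI k) / ((1 - S.ξ) * ∑ j, S.βI j) with he_def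
  have he : 0 ≤ e := by have := hβI k; positivity
  have hM0 : ∀ t, 0 < M t := fun t => (Nat.zero_le _).trans_lt (hM t)
  have hM1 : ∀ t, (1 : ℝ) ≤ M t := fun t => by exact_mod_cast hM0 t
  -- Since `M t ≥ 1`, `M = o(N)` forces `N → ∞`; nothing more is needed from it.
  have hNtop : Tendsto (fun t => (N t : ℝ)) atTop atTop := by
    have h1 : (fun _ : ℕ => (1 : ℝ)) =o[atTop] fun t => (N t : ℝ) :=
      (IsBigO.of_bound 1 (Eventually.of_forall fun t => by
        simpa using hM1 t)).trans_isLittleO hNM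
    simpa using (isLittleO_one_left_iff ℝ).1 h1
  have hN0 : ∀ᶠ t in atTop, 0 < N t := by
    filter_upwards [hNtop.eventually_gt_atTop 0] with t ht
    exact_mod_cast ht
  have hb : Tendsto (fun t => (N t : ℝ)⁻¹) atTop (𝓝 0) := hNtop.inv_tendsto_atTop
  have htr : ∀ t, (H t * (H t)ᴴ).trace.re = M t * N t * S.β₁ := fun t => by
    rw [hH t, RIS.trace_re_losChannel hβ₁.le]
  have hf : Tendsto (fun t => RIS.gramRatio (H t)) atTop (𝓝 (S.β₁ ^ 2)) := by
    have h := hgram.add_const (S.β₁ ^ 2)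
    rw [zero_add] at h
    refine h.congr' ?_
    filter_upwards [hN0] with t ht
    have hMt := hM0 t
    have hcast : ((N t : ℂ)⁻¹) = (((N t : ℝ)⁻¹ : ℝ) : ℂ) := by push_cast; rfl
    -- The exact trace turns the constant and cross terms into `β₁² - 2 β₁² = -β₁²`.
    rw [hcast, RIS.frobSq_smul_gram_sub, htr, RIS.gramRatio]
    field_simp
    ring
  have hfrob : (fun t => RIS.frobSq (H t * (H t)ᴴ)) ~[atTop]
      (fun t => S.β₁ ^ 2 * (N t : ℝ) ^ 2 * (M t : ℝ)) := by
    refine (isEquivalent_iff_tendsto_one ?_).2 ?_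
    · filter_upwards [hN0] with t ht
      have hMt := hM0 t
      positivity
    · have h := hf.div_const (S.β₁ ^ 2)
      rw [div_self (by positivity)] at h
      refine h.congr fun t => ?_
      rw [RIS.gramRatio, div_div, Pi.div_apply]
      congr 1
      ring
  have hU : Tendsto (fun t =>
      RIS.userRate S (RIS.Correlation.uncorrelated (M t) (N t) K) (H t) (RIS.phaseShift (θ t)) k
        - RIS.simpleUserRate S k (M t)) atTop (𝓝 0) := by
    -- `C = a⁻¹` works for unbounded `M`, because `M a ≤ 1 + M a`.
    have h := RIS.tendsto_logb_one_add_mul_sub (q := fun t => (M t : ℝ)) (C := a⁻¹) ha.le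
      (fun t => Nat.cast_nonneg _)
      (fun t => by rw [mul_add, mul_comm _ a, inv_mul_cancel_left₀ ha.ne']; simpa using ha.le)
      (RIS.tendsto_userGain S k hP hξ0 hβ₁ hβI hs hb hf)
    refine h.congr' ?_
    filter_upwards [hN0] with t ht
    rw [RIS.userRate, RIS.gammaUser_eq S (H t) (θ t) k (hM0 t) ht (htr t),
      RIS.simpleUserRate_eq]
  have hE : Tendsto (fun t =>
      RIS.eveCapacity S (RIS.Correlation.uncorrelated (M t) (N t) K) (H t)
          (RIS.phaseShift (θ t)) k
        - RIS.simpleEveCapacity S k (M t)) atTop (𝓝 0) := by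
    have hq0 : ∀ t, 0 ≤ ((M t : ℝ) - K) / ((M t : ℝ) - K - S.ME) := fun t => by
      obtain ⟨hp, hq⟩ := RIS.antennaRatio_eq (hM t)
      rw [hq]; positivity
    -- The limit gain `e` vanishes when `M_E = 0`, so `e⁻¹` is not available. Instead the ratio
    -- itself is at most `1 + M_E`, as the integer `M - K - M_E` is at least 1.
    have hqC : ∀ t, ((M t : ℝ) - K) / ((M t : ℝ) - K - S.ME) ≤
        (1 + S.ME) * (1 + ((M t : ℝ) - K) / ((M t : ℝ) - K - S.ME) * e) := fun t => by
      obtain ⟨hp, hq⟩ := RIS.antennaRatio_eq (hM t)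
      have h1 : (K : ℝ) + S.ME + 1 ≤ M t := by exact_mod_cast hM t
      have h2 : (S.ME : ℝ) / ((M t : ℝ) - K - S.ME) ≤ S.ME :=
        div_le_self (Nat.cast_nonneg _) (by linarith)
      have h3 := mul_nonneg (hq0 t) he
      have h4 : (0 : ℝ) ≤ 1 + S.ME := by positivity
      calc ((M t : ℝ) - K) / ((M t : ℝ) - K - S.ME) ≤ (1 + S.ME) * 1 := by
            rw [hq]; linarith
        _ ≤ _ := by gcongr; linarith
    have h := RIS.tendsto_logb_one_add_mul_sub he hq0 hqC
      (RIS.tendsto_eveGain S k hξ1 hβ₁ hβIE hs' hb hf)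
    refine h.congr' ?_
    filter_upwards [hN0] with t ht
    rw [RIS.eveCapacity, RIS.gammaEve_eq S (H t) (θ t) k (hM0 t) ht (htr t),
      RIS.simpleEveCapacity_eq]
  have hr : RIS.simpleUserRate S k = fun m : ℕ => Real.logb 2 (1 + m * a) :=
    funext (RIS.simpleUserRate_eq S k)
  have hc : RIS.simpleEveCapacity S k = fun m : ℕ =>
      Real.logb 2 (1 + ((m : ℝ) - K) / ((m : ℝ) - K - S.ME) * e) :=
    funext (RIS.simpleEveCapacity_eq S k)
  have hrlim : Tendsto (fun m : ℕ => RIS.simpleUserRate S k m - Real.logb 2 m) atTop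
      (𝓝 (Real.logb 2 a)) := by
    rw [hr]
    exact RIS.tendsto_logb_one_add_mul_sub_logb ha
  refine ⟨hfrob, hU, hE, RIS.tendsto_max_zero_sub hU hE, ?_, hrlim, ?_, ?_, fun hMtop => ?_⟩
  · rw [hr]
    exact RIS.strictMono_logb_one_add_mul ha
  · rw [hc]
    exact RIS.antitoneOn_logb_antennaRatio he K S.ME
  · intro m hm
    rw [hc]
    exact RIS.logb_antennaRatio_bounds he hm
  · have hU' : Tendsto (fun t =>
        RIS.userRate S (RIS.Correlation.uncorrelated (M t) (N t) K) (H t)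
            (RIS.phaseShift (θ t)) k - Real.logb 2 (M t)) atTop (𝓝 (Real.logb 2 a)) := by
      simpa using hU.add (hrlim.comp hMtop)
    have hE' : Tendsto (fun t =>
        RIS.eveCapacity S (RIS.Correlation.uncorrelated (M t) (N t) K) (H t)
            (RIS.phaseShift (θ t)) k) atTop (𝓝 (RIS.eveCapacityLimit S k)) := by
      have h := (RIS.tendsto_logb_antennaRatio he K S.ME).comp hMtop
      rw [← hc] at h
      rw [RIS.eveCapacityLimit, ← he_def]
      simpa using hE.add h
    refine ⟨hU', hE', RIS.tendsto_max_zero_sub_of_atTop ?_ hU' hE'⟩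
    exact (Real.tendsto_logb_atTop one_lt_two).comp (tendsto_natCast_atTop_atTop.comp hMtop)
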